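/- Consider the two-stage robust optimization problem with decision-dependent uncertainty, with continuous uncertainty and recourse, $$\textbf{2-Stg RO}:\quad w^*=\min_{x\in\mathcal X}\; c_1x+\max_{u\in\mathcal U(x)}\;\min_{y\in\mathcal Y(x,u)}c_2y,$$ where $\mathcal X=\{x\in\mathbb Z_+^{m_x}\times\mathbb R_+^{n_x}: Ax\ge b\}$, $\mathcal U(x)=\{u\in\mathbb R_+^{n_u}: F(x)u\le h+Gx\}$ with $F$ an arbitrary matrix-valued function of $x$, and $\mathcal Y(x,u)=\{y\in\mathbb R_+^{n_y}: B_2y\ge d-B_1x-Eu\}$. An infeasible minimization has optimal value $+\infty$. Assume: (A1) $\mathcal U(x)\ne\emptyset$ for all $x\in\mathcal X$; (A2) $\mathcal U(x)$ is bounded for all $x\in\mathcal X$; (A3) the problem $\min\{c_1x+c_2y: x\in\mathcal X,\ u\in\mathcal U(x),\ y\in\mathcal Y(x,u)\}$ has a finite optimal value. Let $\Pi=\{\pi\ge 0: B_2^\top\pi\le c_2^\top\}$, let $\mathcal P_\Pi$ be the set of its extreme points and $\mathcal R_\Pi$ the set of its extreme rays (extreme rays of the recession cone $\{\gamma\ge0: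 B_2^\top\gamma\le0\}$, each listed through exactly one arbitrarily scaled generator). For any vector $\beta$, let $\mathrm{LP}(x,\beta)$ be $\max\{(-Eu)^\top\beta: u\in\mathcal U(x)\}$, and let $\mathrm{KKT}(x,\beta)$ be the set of $(u,\lambda)$ with $u,\lambda\ge0$, $F(x)u\le h+Gx$, $F(x)^\top\lambda\ge -E^\top\beta$, $\lambda\circ(h+Gx-F(x)u)=0$, $u\circ(F(x)^\top\lambda+E^\top\beta)=0$. Write $\mathcal{OU}(x,\pi)=\mathrm{KKT}(x,\pi)$ for $\pi\in\mathcal P_\Pi$, $\mathcal{OV}(x,\gamma)=\mathrm{KKT}(x,\gamma)$ for $\gamma\in\mathcal R_\Pi$, and a subscript $u$ for projection onto the $u$-space. Two formulations are called equivalent if they have the same optimal value and the same optimal first-stage solutions $x$ (first-stage parts of feasible points that attain a finite optimal value). Then: 1. $\mathcal P_\Pi$ is finite and non-empty, and $\mathcal R_\Pi$ is finite. 2. For every $x\in\mathcal X$ and every $\beta$, the projection of $\mathrm{KKT}(x,\beta)$ onto the $u$-space is the set of optimal solutions of $\mathrm{LP}(x,\beta)$. 3. For every $x\in\mathcal X$,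 with $\mathcal U^*(x)=\bigcup_{\pi\in\mathcal P_\Pi}\mathcal{OU}_u(x,\pi)$ and $\mathcal V^*(x)=\bigcup_{\gamma\in\mathcal R_\Pi}\mathcal{OV}_u(x,\gamma)$, one has $\mathcal U^*(x)\cup\mathcal V^*(x)\subseteq\mathcal U(x)$ and $$\max_{u\in\mathcal U(x)}\min\{c_2y:y\in\mathcal Y(x,u)\}=\max_{u\in\mathcal U^*(x)\cup\mathcal V^*(x)}\min\{c_2y:y\in\mathcal Y(x,u)\}$$ in the extended reals, both maxima being attained (at a common $u\in\mathcal U^*(x)\cup\mathcal V^*(x)$). 4. 2-Stg RO, the bilevel program $$\textbf{2-Stg RO}(\Omega_\Pi):\ \min\ c_1x+\eta\ \text{ s.t. } x\in\mathcal X;\ \ \eta\ge c_2y^\pi,\ y^\pi\in\mathcal Y(x,u^\pi),\ u^\pi\in\arg\max_{u\in\mathcal U(x)}(-Eu)^\top\pi\ \ \forall\pi\in\mathcal P_\Pi;\ \ y^\gamma\in\mathcal Y(x,v^\gamma),\ v^\gamma\in\arg\max_{v\in\mathcal U(x)}(-Ev)^\top\gamma\ \ \forall\gamma\in\mathcal R_\Pi,$$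 and the single-level program $\textbf{2-Stg RO}(\Omega^K_\Pi)$, obtained from it by replacing the two argmax conditions by $(u^\pi,\lambda^\pi)\in\mathcal{OU}(x,\pi)$ and $(v^\gamma,\zeta^\gamma)\in\mathcal{OV}(x,\gamma)$ with additional variables $\lambda^\pi,\zeta^\gamma$, are pairwise equivalent. In particular each has optimal value $w^*$. 5. The following other formulations are also equivalent to $\textbf{2-Stg RO}(\Omega_\Pi)$: - the epigraph form: $\min c_1x+\eta$ over $x\in\mathcal X$ and $\eta\in\mathbb R$ such that every $u\in\mathcal U(x)$ admits $y\in\mathcal Y(x,u)$ with $c_2y\le\eta$; - the dualized form: $\min_{x\in\mathcal X}c_1x+\max\{(d-B_1x-Eu)^\top\pi:u\in\mathcal U(x),\pi\in\Pi\}$; - $\textbf{2-Stg RO}(\Sigma_\Pi)$: $\min c_1x+\eta$ s.t. $x\in\mathcal X$, $\eta\ge(d-B_1x)^\top\pi+\max_{u\in\mathcal U(x)}(-Eu)^\top\pi$ for all $\pi\in\mathcal P_\Pi$, and $(d-B_1x)^\top\gamma+\max_{v\in\mathcal U(x)}(-Ev)^\top\gamma\le0$ for all $\gamma\in\mathcal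 R_\Pi$; - $\textbf{2-Stg RO}(\Sigma^K_\Pi)$: $\min c_1x+\eta$ s.t. $x\in\mathcal X$, $\eta\ge\pi^\top d-\pi^\top B_1x-\pi^\top Eu^\pi$ and $(u^\pi,\lambda^\pi)\in\mathcal{OU}(x,\pi)$ for all $\pi\in\mathcal P_\Pi$, and $\gamma^\top d-\gamma^\top B_1x-\gamma^\top Ev^\gamma\le0$ and $(v^\gamma,\zeta^\gamma)\in\mathcal{OV}(x,\gamma)$ for all $\gamma\in\mathcal R_\Pi$. -/

import Mathlib

open Matrix

/-- An optimization program whose decision variables `Var` contain a first-stage decision `x`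
(a vector indexed by `ι`) : minimize `objective` over `feasible`. -/
structure FirstStageProgram (ι : Type) where
  Var : Type
  firstStage : Var → ι → ℝ
  feasible : Set Var
  objective : Var → EReal

namespace FirstStageProgram

variable {ι : Type}

/-- The optimal value (`⊤` for an infeasible program). -/
noncomputable def value (P : FirstStageProgram ι) : EReal :=
  ⨅ z ∈ P.feasible, P.objective z

/-- `z` is an optimal solution: a feasible point with finite objective attaining the optimal
value. -/
def IsOptimal (P : FirstStageProgram ι) (z : P.Var) : Prop :=
  z ∈ P.feasible ∧ P.objective z ≠ ⊤ ∧ P.objective z ≠ ⊥ ∧ P.objective z = P.value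

/-- `x` is an optimal first-stage solution: the first-stage part of an optimal solution. -/
def IsOptimalFirstStage (P : FirstStageProgram ι) (x : ι → ℝ) : Prop :=
  ∃ z : P.Var, P.IsOptimal z ∧ P.firstStage z = x

/-- Two formulations are equivalent if they share the optimal value, and the optimal first-stage
solutions of each are optimal to the other one. -/
def Equivalent (P Q : FirstStageProgram ι) : Prop :=
  P.value = Q.value ∧ ∀ x : ι → ℝ, P.IsOptimalFirstStage x ↔ Q.IsOptimalFirstStage x

end FirstStageProgram

/-- The coefficients of a two-stage robust problem with decision-dependent uncertainty, with
continuous uncertainty set and continuous recourse. The first-stage variable has `mx` integer and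
`nx` continuous components; `rx`, `ru`, `ry` are the numbers of rows of the constraint systems. -/
structure TwoStageRO (mx nx nu ny rx ru ry : ℕ) where
  c₁ : Fin mx ⊕ Fin nx → ℝ
  A : Matrix (Fin rx) (Fin mx ⊕ Fin nx) ℝ
  b : Fin rx → ℝ
  F : (Fin mx ⊕ Fin nx → ℝ) → Matrix (Fin ru) (Fin nu) ℝ
  h : Fin ru → ℝ
  G : Matrix (Fin ru) (Fin mx ⊕ Fin nx) ℝ
  c₂ : Fin ny → ℝ
  B₁ : Matrix (Fin ry) (Fin mx ⊕ Fin nx) ℝ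
  B₂ : Matrix (Fin ry) (Fin ny) ℝ
  d : Fin ry → ℝ
  E : Matrix (Fin ry) (Fin nu) ℝ

namespace TwoStageRO

variable {mx nx nu ny rx ru ry : ℕ} (D : TwoStageRO mx nx nu ny rx ru ry)

/-- The first-stage feasible set `X`. -/
def X : Set (Fin mx ⊕ Fin nx → ℝ) :=
  {x | 0 ≤ x ∧ (∀ i : Fin mx, ∃ k : ℤ, x (Sum.inl i) = k) ∧ D.b ≤ D.A *ᵥ x}

/-- The uncertainty set `U(x)`. -/
def U (x : Fin mx ⊕ Fin nx → ℝ) : Set (Fin nu → ℝ) :=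
  {u | 0 ≤ u ∧ D.F x *ᵥ u ≤ D.h + D.G *ᵥ x}

/-- The recourse feasible set `Y(x, u)`. -/
def Y (x : Fin mx ⊕ Fin nx → ℝ) (u : Fin nu → ℝ) : Set (Fin ny → ℝ) :=
  {y | 0 ≤ y ∧ D.d - D.B₁ *ᵥ x - D.E *ᵥ u ≤ D.B₂ *ᵥ y}

/-- `U(x)` is non-empty for every `x ∈ X`. -/
def A1 : Prop := ∀ x ∈ D.X, (D.U x).Nonempty

/-- `U(x)` is bounded for every `x ∈ X`. -/
def A2 : Prop := ∀ x ∈ D.X, Bornology.IsBounded (D.U x)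

/-- The values `c₁ x + c₂ y` over `x ∈ X`, `u ∈ U(x)`, `y ∈ Y(x, u)`. -/
def jointValues : Set ℝ :=
  {r | ∃ x ∈ D.X, ∃ u ∈ D.U x, ∃ y ∈ D.Y x u, r = D.c₁ ⬝ᵥ x + D.c₂ ⬝ᵥ y}

/-- The problem of minimizing `c₁ x + c₂ y` over `x ∈ X`, `u ∈ U(x)`, `y ∈ Y(x, u)` has a finite
optimal value. -/
def A3 : Prop := D.jointValues.Nonempty ∧ BddBelow D.jointValues

/-- The optimal value of the recourse problem, `min {c₂ y : y ∈ Y(x, u)}`. -/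
noncomputable def recourse (x : Fin mx ⊕ Fin nx → ℝ) (u : Fin nu → ℝ) : EReal :=
  ⨅ y ∈ D.Y x u, ((D.c₂ ⬝ᵥ y : ℝ) : EReal)

/-- The worst-case recourse value over a set `S` of scenarios. -/
noncomputable def worstCase (x : Fin mx ⊕ Fin nx → ℝ) (S : Set (Fin nu → ℝ)) : EReal :=
  ⨆ u ∈ S, D.recourse x u

/-- The feasible set `Π` of the dual of the recourse problem. -/
def dualPoly : Set (Fin ry → ℝ) :=
  {p | 0 ≤ p ∧ D.B₂ᵀ *ᵥ p ≤ D.c₂}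

/-- The extreme points of `Π`. -/
def extPts : Set (Fin ry → ℝ) := D.dualPoly.extremePoints ℝ

/-- The recession cone of the polyhedron `Π`. -/
def recCone : Set (Fin ry → ℝ) :=
  {g | 0 ≤ g ∧ D.B₂ᵀ *ᵥ g ≤ 0}

/-- `g` generates an extreme ray of `Π`: the half-line `{t g : t ≥ 0}` is a one-dimensional
extreme subset of the recession cone. -/
def IsExtremeRay (g : Fin ry → ℝ) : Prop :=
  g ≠ 0 ∧ IsExtreme ℝ D.recCone {g' | ∃ t : ℝ, 0 ≤ t ∧ g' = t • g}

/-- `R` is the set of extreme rays of `Π`, each ray being listed through exactly one generator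
(arbitrarily scaled). -/
def IsExtremeRaySet (R : Set (Fin ry → ℝ)) : Prop :=
  (∀ g ∈ R, D.IsExtremeRay g) ∧
    ∀ g, D.IsExtremeRay g → ∃! g', g' ∈ R ∧ SameRay ℝ g g'

/-- The optimal value of `LP(x, β) = max {(-E u)ᵀ β : u ∈ U(x)}`. -/
noncomputable def lpValue (x : Fin mx ⊕ Fin nx → ℝ) (β : Fin ry → ℝ) : EReal :=
  ⨆ u ∈ D.U x, ((-(D.E *ᵥ u) ⬝ᵥ β : ℝ) : EReal)

/-- The set of optimal solutions of `LP(x, β)`. -/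
def lpArgmax (x : Fin mx ⊕ Fin nx → ℝ) (β : Fin ry → ℝ) : Set (Fin nu → ℝ) :=
  {u | u ∈ D.U x ∧ ∀ u' ∈ D.U x, -(D.E *ᵥ u') ⬝ᵥ β ≤ -(D.E *ᵥ u) ⬝ᵥ β}

/-- The Karush-Kuhn-Tucker set of `LP(x, β)`: it is `OU(x, β)` for an extreme point `β` of `Π`,
and `OV(x, β)` for an extreme ray `β` of `Π`. -/
def kkt (x : Fin mx ⊕ Fin nx → ℝ) (β : Fin ry → ℝ) : Set ((Fin nu → ℝ) × (Fin ru → ℝ)) :=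
  {q | D.F x *ᵥ q.1 ≤ D.h + D.G *ᵥ x ∧
    -(D.Eᵀ *ᵥ β) ≤ (D.F x)ᵀ *ᵥ q.2 ∧
    q.2 * (D.h + D.G *ᵥ x - D.F x *ᵥ q.1) = 0 ∧
    q.1 * ((D.F x)ᵀ *ᵥ q.2 + D.Eᵀ *ᵥ β) = 0 ∧
    0 ≤ q.1 ∧ 0 ≤ q.2}

/-- The projection of the Karush-Kuhn-Tucker set onto the space of `u`. -/
def kktProj (x : Fin mx ⊕ Fin nx → ℝ) (β : Fin ry → ℝ) : Set (Fin nu → ℝ) :=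
  {u | ∃ l, (u, l) ∈ D.kkt x β}

/-- `U*(x) ∪ V*(x)`, the union of the projected sets `OU(x, π)` over the extreme points `π` and
`OV(x, γ)` over the extreme rays `γ ∈ R`. -/
def criticalSet (R : Set (Fin ry → ℝ)) (x : Fin mx ⊕ Fin nx → ℝ) : Set (Fin nu → ℝ) :=
  (⋃ p ∈ D.extPts, D.kktProj x p) ∪ (⋃ g ∈ R, D.kktProj x g)

/-- The problem `min_{x ∈ X} c₁ x + max_{u ∈ U(x)} min_{y ∈ Y(x, u)} c₂ y`. -/
noncomputable def original : FirstStageProgram (Fin mx ⊕ Fin nx) where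
  Var := Fin mx ⊕ Fin nx → ℝ
  firstStage x := x
  feasible := D.X
  objective x := ((D.c₁ ⬝ᵥ x : ℝ) : EReal) + D.worstCase x (D.U x)

/-- The epigraph formulation in `(x, η)`. -/
noncomputable def epigraph : FirstStageProgram (Fin mx ⊕ Fin nx) where
  Var := (Fin mx ⊕ Fin nx → ℝ) × ℝ
  firstStage z := z.1
  feasible := {z | z.1 ∈ D.X ∧ ∀ u ∈ D.U z.1, ∃ y ∈ D.Y z.1 u, D.c₂ ⬝ᵥ y ≤ z.2}
  objective z := ((D.c₁ ⬝ᵥ z.1 + z.2 : ℝ) : EReal)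

/-- The formulation obtained by dualizing the recourse problem:
`min_{x ∈ X} c₁ x + max {(d - B₁ x - E u)ᵀ π : u ∈ U(x), π ∈ Π}`. -/
noncomputable def dualized : FirstStageProgram (Fin mx ⊕ Fin nx) where
  Var := Fin mx ⊕ Fin nx → ℝ
  firstStage x := x
  feasible := D.X
  objective x := ((D.c₁ ⬝ᵥ x : ℝ) : EReal) +
    ⨆ u ∈ D.U x, ⨆ p ∈ D.dualPoly, (((D.d - D.B₁ *ᵥ x - D.E *ᵥ u) ⬝ᵥ p : ℝ) : EReal)

/-- The bilevel program `2-Stg RO(Σ_Π)` in `(x, η)`, with one cut per extreme point or ray. -/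
noncomputable def sigma (R : Set (Fin ry → ℝ)) : FirstStageProgram (Fin mx ⊕ Fin nx) where
  Var := (Fin mx ⊕ Fin nx → ℝ) × ℝ
  firstStage z := z.1
  feasible := {z | z.1 ∈ D.X ∧
    (∀ p ∈ D.extPts,
      (((D.d - D.B₁ *ᵥ z.1) ⬝ᵥ p : ℝ) : EReal) + D.lpValue z.1 p ≤ (z.2 : EReal)) ∧
    (∀ g ∈ R, (((D.d - D.B₁ *ᵥ z.1) ⬝ᵥ g : ℝ) : EReal) + D.lpValue z.1 g ≤ 0)}
  objective z := ((D.c₁ ⬝ᵥ z.1 + z.2 : ℝ) : EReal)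

/-- The variables of `2-Stg RO(Σᴷ_Π)`. -/
structure SigmaKVar (R : Set (Fin ry → ℝ)) where
  x : Fin mx ⊕ Fin nx → ℝ
  η : ℝ
  u : D.extPts → Fin nu → ℝ
  lam : D.extPts → Fin ru → ℝ
  v : R → Fin nu → ℝ
  zeta : R → Fin ru → ℝ

/-- The single-level program `2-Stg RO(Σᴷ_Π)`. -/
noncomputable def sigmaK (R : Set (Fin ry → ℝ)) : FirstStageProgram (Fin mx ⊕ Fin nx) where
  Var := D.SigmaKVar R
  firstStage z := z.x
  feasible := {z | z.x ∈ D.X ∧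
    (∀ p : D.extPts,
      (p : Fin ry → ℝ) ⬝ᵥ D.d - (p : Fin ry → ℝ) ⬝ᵥ (D.B₁ *ᵥ z.x)
        - (p : Fin ry → ℝ) ⬝ᵥ (D.E *ᵥ z.u p) ≤ z.η ∧
      (z.u p, z.lam p) ∈ D.kkt z.x p) ∧
    (∀ g : R,
      (g : Fin ry → ℝ) ⬝ᵥ D.d - (g : Fin ry → ℝ) ⬝ᵥ (D.B₁ *ᵥ z.x)
        - (g : Fin ry → ℝ) ⬝ᵥ (D.E *ᵥ z.v g) ≤ 0 ∧
      (z.v g, z.zeta g) ∈ D.kkt z.x g)}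
  objective z := ((D.c₁ ⬝ᵥ z.x + z.η : ℝ) : EReal)

/-- The variables of `2-Stg RO(Ω_Π)`: one replicate of the scenario and of the recourse variable
for every extreme point (`u`, `y`) and for every extreme ray (`v`, `yRay`). -/
structure OmegaVar (R : Set (Fin ry → ℝ)) where
  x : Fin mx ⊕ Fin nx → ℝ
  η : ℝ
  u : D.extPts → Fin nu → ℝ
  y : D.extPts → Fin ny → ℝ
  v : R → Fin nu → ℝ
  yRay : R → Fin ny → ℝ

/-- The bilevel program `2-Stg RO(Ω_Π)`. -/
noncomputable def omega (R : Set (Fin ry → ℝ)) : FirstStageProgram (Fin mx ⊕ Fin nx) where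
  Var := D.OmegaVar R
  firstStage z := z.x
  feasible := {z | z.x ∈ D.X ∧
    (∀ p : D.extPts,
      D.c₂ ⬝ᵥ z.y p ≤ z.η ∧ z.y p ∈ D.Y z.x (z.u p) ∧ z.u p ∈ D.lpArgmax z.x p) ∧
    (∀ g : R, z.yRay g ∈ D.Y z.x (z.v g) ∧ z.v g ∈ D.lpArgmax z.x g)}
  objective z := ((D.c₁ ⬝ᵥ z.x + z.η : ℝ) : EReal)

/-- The variables of `2-Stg RO(Ωᴷ_Π)`: those of `2-Stg RO(Ω_Π)` and the lower-level dual
variables. -/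
structure OmegaKVar (R : Set (Fin ry → ℝ)) extends OmegaVar D R where
  lam : D.extPts → Fin ru → ℝ
  zeta : R → Fin ru → ℝ

/-- The single-level program `2-Stg RO(Ωᴷ_Π)`. -/
noncomputable def omegaK (R : Set (Fin ry → ℝ)) : FirstStageProgram (Fin mx ⊕ Fin nx) where
  Var := D.OmegaKVar R
  firstStage z := z.x
  feasible := {z | z.x ∈ D.X ∧
    (∀ p : D.extPts,
      D.c₂ ⬝ᵥ z.y p ≤ z.η ∧ 0 ≤ z.y p ∧
      D.d - D.B₁ *ᵥ z.x - D.E *ᵥ z.u p ≤ D.B₂ *ᵥ z.y p ∧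
      (z.u p, z.lam p) ∈ D.kkt z.x p) ∧
    (∀ g : R,
      D.d - D.B₁ *ᵥ z.x - D.E *ᵥ z.v g ≤ D.B₂ *ᵥ z.yRay g ∧ 0 ≤ z.yRay g ∧
      (z.v g, z.zeta g) ∈ D.kkt z.x g)}
  objective z := ((D.c₁ ⬝ᵥ z.x + z.η : ℝ) : EReal)

end TwoStageRO

/-! For fixed `x` and `u`, LP duality turns a bound `recourse x u ≤ v` with `v` real into `(d - B₁x
- Eu)ᵀπ ≤ v` for all `π ∈ Π`. Since `Π` lies in the nonnegative orthant, it is pointed, so this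
family reduces to one inequality per extreme point and a sign condition per extreme ray
(`dotProduct_le_of_le_on_generators`). For each generator separately, the worst `u ∈ U(x)` is an
optimal solution of a linear program. Hence the worst case is at most `v` as soon as each inequality
holds at one such maximizer (`worstCase_le_of_lpArgmax`); these maximizers form the critical set,
and the KKT conditions describe them exactly (`kktProj_eq_lpArgmax`).

Every reformulation then has the same shape: over a given `x`, the attainable real `η` are exactly
the upper bounds of the worst case. `original_equivalent_of_feasible_iff` derives equivalence with
the original problem from this alone. (A1) and (A2) make the lower-level maximizers exist; (A3)
makes `Π` non-empty, which keeps recourse values away from `⊥`. -/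

/-! ### Farkas' lemma and linear programming duality -/

/-- Farkas' lemma for finitely many linear functionals. -/
theorem exists_nonneg_combination_of_forall_le {V ι : Type*} [AddCommGroup V] [Module ℝ V]
    [DecidableEq ι] (s : Finset ι) :
    ∀ (a : ι → V →ₗ[ℝ] ℝ) (c : V →ₗ[ℝ] ℝ), (∀ x, (∀ i ∈ s, a i x ≤ 0) → c x ≤ 0) →
      ∃ l : ι → ℝ, 0 ≤ l ∧ c = ∑ i ∈ s, l i • a i := by
  induction s using Finset.induction_on with
  | empty =>
    intro a c hc
    refine ⟨0, le_rfl, LinearMap.ext fun x => ?_⟩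
    have h1 := hc x (by simp)
    have h2 := hc (-x) (by simp)
    rw [map_neg] at h2
    simp only [Finset.sum_empty, LinearMap.zero_apply]
    linarith
  | insert k s hk ih =>
    intro a c hc
    by_cases h : ∀ x, (∀ i ∈ s, a i x ≤ 0) → c x ≤ 0
    · obtain ⟨l, hl, rfl⟩ := ih a c h
      refine ⟨Function.update l k 0, ?_, ?_⟩
      · intro i
        by_cases hi : i = k
        · subst hi; simp
        · simpa [hi] using hl i
      · rw [Finset.sum_insert hk]
        simp only [Function.update_self, zero_smul, zero_add]
        refine Finset.sum_congr rfl fun i hi => ?_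
        rw [Function.update_of_ne (ne_of_mem_of_not_mem hi hk)]
    -- Here `a k` is indispensable: some `z` satisfies the other inequalities but has `c z > 0`, so
    -- `a k z > 0`. Projecting along `z` onto the kernel of `a k` eliminates `a k`, and the
    -- induction hypothesis applies to the projected functionals.
    · push Not at h
      obtain ⟨z, hz, hcz⟩ := h
      have hkz : 0 < a k z := by
        by_contra hneg
        refine absurd (hc z fun i hi => ?_) (not_le.mpr hcz)
        rcases Finset.mem_insert.mp hi with rfl | hi
        · exact not_lt.mp hneg
        · exact hz i hi
      obtain ⟨l, hl, hcl⟩ := ih (fun i => a i - (a i z / a k z) • a k)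
        (c - (c z / a k z) • a k) (by
          intro x hx
          have := hc (x - (a k x / a k z) • z) (by
            intro i hi
            rcases Finset.mem_insert.mp hi with rfl | hi
            · simp [hkz.ne']
            · have := hx i hi
              simp only [LinearMap.sub_apply, LinearMap.smul_apply, smul_eq_mul, map_sub,
                map_smul] at this ⊢
              calc _ = _ := by ring
                _ ≤ 0 := this)
          simp only [LinearMap.sub_apply, LinearMap.smul_apply, smul_eq_mul, map_sub,
            map_smul] at this ⊢
          calc _ = _ := by ring
            _ ≤ 0 := this)
      -- Undoing the projection collects this coefficient on `a k`; it is nonnegative because `c z >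
      -- 0` while `a i z ≤ 0` on `s`.
      set r : ℝ := c z / a k z - ∑ i ∈ s, l i * (a i z / a k z) with hr
      have hr0 : 0 ≤ r := by
        have h1 : 0 ≤ c z / a k z := by positivity
        have h2 : ∑ i ∈ s, l i * (a i z / a k z) ≤ 0 :=
          Finset.sum_nonpos fun i hi => mul_nonpos_of_nonneg_of_nonpos (hl i)
            (div_nonpos_of_nonpos_of_nonneg (hz i hi) hkz.le)
        linarith
      refine ⟨Function.update l k r, ?_, ?_⟩
      · intro i
        by_cases hi : i = k
        · subst hi; simpa using hr0
        · simpa [hi] using hl i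
      · rw [Finset.sum_insert hk, Function.update_self,
          Finset.sum_congr rfl fun i hi => by
            rw [Function.update_of_ne (ne_of_mem_of_not_mem hi hk)]]
        refine LinearMap.ext fun x => ?_
        have := LinearMap.congr_fun hcl x
        simp only [LinearMap.sub_apply, LinearMap.smul_apply, smul_eq_mul,
          LinearMap.sum_apply, LinearMap.add_apply, mul_sub, Finset.sum_sub_distrib] at this ⊢
        rw [hr, sub_mul, Finset.sum_mul]
        simp only [mul_assoc] at this ⊢
        linarith

/-- Strong duality: the dual of a feasible linear program whose objective is bounded below by `v`
has a solution of objective at least `v`. -/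
theorem exists_dual_of_primal_le {m n : Type*} [Fintype m] [Fintype n]
    (B : Matrix m n ℝ) (b : m → ℝ) (c : n → ℝ) (v : ℝ)
    (hne : ∃ y, 0 ≤ y ∧ b ≤ B *ᵥ y) (hv : ∀ y, 0 ≤ y → b ≤ B *ᵥ y → v ≤ c ⬝ᵥ y) :
    ∃ p, 0 ≤ p ∧ Bᵀ *ᵥ p ≤ c ∧ v ≤ b ⬝ᵥ p := by
  classical
  -- Homogenize: on pairs `(y, t)`, the conditions `t b ≤ B y`, `y ≥ 0`, `t ≥ 0` imply `t v ≤ c y`.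
  -- Farkas multipliers of the first block form the dual solution, and its two inequalities are read
  -- off at `(eⱼ, 0)` and `(0, 1)`.
  let π₁ : (n → ℝ) × ℝ →ₗ[ℝ] (n → ℝ) := LinearMap.fst ℝ _ _
  let π₂ : (n → ℝ) × ℝ →ₗ[ℝ] ℝ := LinearMap.snd ℝ _ _
  let a : m ⊕ (n ⊕ Unit) → (n → ℝ) × ℝ →ₗ[ℝ] ℝ :=
    Sum.elim (fun i => b i • π₂ - LinearMap.proj i ∘ₗ B.mulVecLin ∘ₗ π₁)
      (Sum.elim (fun j => -(LinearMap.proj j ∘ₗ π₁)) fun _ => -π₂)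
  let f : (n → ℝ) × ℝ →ₗ[ℝ] ℝ := v • π₂ - (dotProductBilin ℝ ℝ c) ∘ₗ π₁
  have hf : ∀ z : (n → ℝ) × ℝ, f z = v * z.2 - c ⬝ᵥ z.1 := fun z => rfl
  obtain ⟨l, hl, hfl⟩ := exists_nonneg_combination_of_forall_le Finset.univ a f (by
    rintro ⟨y, t⟩ h
    have h1 : ∀ i, b i * t ≤ (B *ᵥ y) i := fun i => sub_nonpos.mp (h (Sum.inl i) (by simp))
    have h2 : 0 ≤ y := fun j => neg_nonpos.mp (h (Sum.inr (Sum.inl j)) (by simp))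
    have h3 : 0 ≤ t := neg_nonpos.mp (h (Sum.inr (Sum.inr ())) (by simp))
    rw [hf]
    rcases h3.eq_or_lt with rfl | ht
    · obtain ⟨y₀, hy₀, hb₀⟩ := hne
      by_contra! hneg
      simp only [mul_zero, zero_sub, Left.neg_pos_iff] at hneg h1
      have key : ∀ s : ℝ, 0 ≤ s → v ≤ c ⬝ᵥ y₀ + s * (c ⬝ᵥ y) := by
        intro s hs
        have := hv (y₀ + s • y) (add_nonneg hy₀ (smul_nonneg hs h2)) (by
          intro i
          have e1 := hb₀ i
          have e2 := mul_nonneg hs (h1 i)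
          simp only [mulVec_add, mulVec_smul, Pi.add_apply, Pi.smul_apply, smul_eq_mul]
          linarith)
        simpa [dotProduct_add, dotProduct_smul] using this
      have h4 := key 0 le_rfl
      -- The step length at which the objective along the recession direction `y` falls to `v - 1`.
      have h5 := key ((c ⬝ᵥ y₀ - v + 1) / (-(c ⬝ᵥ y)))
        (div_nonneg (by linarith) (by linarith))
      have h6 : (c ⬝ᵥ y₀ - v + 1) / (-(c ⬝ᵥ y)) * (c ⬝ᵥ y) = -(c ⬝ᵥ y₀ - v + 1) := by
        rw [div_neg, neg_mul, div_mul_cancel₀ _ hneg.ne]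
      linarith
    · have := hv (t⁻¹ • y) (smul_nonneg (by positivity) h2) (by
        intro i
        rw [mulVec_smul, Pi.smul_apply, smul_eq_mul, le_inv_mul_iff₀ ht]
        linarith [h1 i])
      rw [dotProduct_smul, smul_eq_mul, le_inv_mul_iff₀ ht] at this
      simp only
      linarith)
  have hl' := fun z => LinearMap.congr_fun hfl z
  have ha1 : ∀ i z, a (Sum.inl i) z = b i * z.2 - (B *ᵥ z.1) i := fun _ _ => rfl
  have ha2 : ∀ j z, a (Sum.inr (Sum.inl j)) z = - z.1 j := fun _ _ => rfl
  have ha3 : ∀ z, a (Sum.inr (Sum.inr ())) z = - z.2 := fun _ => rfl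
  simp only [LinearMap.sum_apply, LinearMap.smul_apply, smul_eq_mul] at hl'
  simp only [Fintype.sum_sum_type, hf, ha1, ha2, ha3, Finset.univ_unique, PUnit.default_eq_unit, Finset.sum_singleton] at hl'
  refine ⟨fun i => l (Sum.inl i), fun i => hl _, fun j => ?_, ?_⟩
  · have := hl' (Pi.single j 1, 0)
    have hj := hl (Sum.inr (Sum.inl j))
    simp only [Pi.zero_apply] at hj
    simp only [mul_zero, dotProduct_single, mul_one, zero_sub, mulVec_single_one, col_apply,
      mul_neg, Finset.sum_neg_distrib, Pi.single_apply, mul_ite,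
      Finset.sum_ite_eq', Finset.mem_univ, if_true, neg_zero, add_zero] at this
    have e : (Bᵀ *ᵥ fun i => l (Sum.inl i)) j = ∑ i, l (Sum.inl i) * B i j := by
      simp [mulVec, dotProduct, mul_comm]
    rw [e]
    linarith
  · have := hl' (0, 1)
    have h0 := hl (Sum.inr (Sum.inr ()))
    simp only [Pi.zero_apply] at h0
    simp only [mul_one, dotProduct_zero, sub_zero, mulVec_zero, Pi.zero_apply, neg_zero, mul_zero,
      Finset.sum_const_zero, zero_add, mul_neg] at this
    have e : (b ⬝ᵥ fun i => l (Sum.inl i)) = ∑ i, l (Sum.inl i) * b i := by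
      simp [dotProduct, mul_comm]
    rw [e]
    linarith

/-- Weak duality. -/
theorem dual_le_primal {m n : Type*} [Fintype m] [Fintype n]
    {B : Matrix m n ℝ} {b : m → ℝ} {c : n → ℝ} {y : n → ℝ} {p : m → ℝ}
    (hy : 0 ≤ y) (hb : b ≤ B *ᵥ y) (hp : 0 ≤ p) (hc : Bᵀ *ᵥ p ≤ c) : b ⬝ᵥ p ≤ c ⬝ᵥ y :=
  calc b ⬝ᵥ p ≤ (B *ᵥ y) ⬝ᵥ p := dotProduct_le_dotProduct_of_nonneg_right hb hp
    _ = (Bᵀ *ᵥ p) ⬝ᵥ y := by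
      rw [dotProduct_comm, dotProduct_mulVec, mulVec_transpose]
    _ ≤ c ⬝ᵥ y := dotProduct_le_dotProduct_of_nonneg_right hc hy

/-- Strong duality: the primal of a feasible dual program whose objective is bounded above by `v`
has a solution of objective at most `v`. -/
theorem exists_primal_of_dual_le {m n : Type*} [Fintype m] [Fintype n]
    (B : Matrix m n ℝ) (b : m → ℝ) (c : n → ℝ) (v : ℝ)
    (hne : ∃ p, 0 ≤ p ∧ Bᵀ *ᵥ p ≤ c) (hv : ∀ p, 0 ≤ p → Bᵀ *ᵥ p ≤ c → b ⬝ᵥ p ≤ v) :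
    ∃ y, 0 ≤ y ∧ b ≤ B *ᵥ y ∧ c ⬝ᵥ y ≤ v := by
  obtain ⟨y, hy, h1, h2⟩ := exists_dual_of_primal_le (-Bᵀ) (-c) (-b) (-v)
    (by simpa [neg_mulVec] using hne) (by
      intro p hp h
      rw [neg_mulVec, neg_le_neg_iff] at h
      simpa using hv p hp h)
  refine ⟨y, hy, ?_, ?_⟩
  · simpa [neg_mulVec] using h1
  · simpa using h2

/-! ### Extreme points and extreme rays of polyhedra -/

section Polyhedra

variable {V ι : Type*} [AddCommGroup V] [Module ℝ V]

/-- The polyhedron `{p : a i p ≤ b i for all i}`. -/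
def halfspaceInter (a : ι → V →ₗ[ℝ] ℝ) (b : ι → ℝ) : Set V := {p | ∀ i, a i p ≤ b i}

/-- The number of constraints that are not tight at `p`. -/
noncomputable def slackCount (a : ι → V →ₗ[ℝ] ℝ) (b : ι → ℝ) (p : V) : ℕ :=
  {i | a i p ≠ b i}.ncard

variable {a : ι → V →ₗ[ℝ] ℝ} {b : ι → ℝ} {p d : V}

/-- A point of a polyhedron that is not extreme admits a direction along which the tight
constraints stay tight. -/
theorem exists_direction_of_not_extreme (hp : p ∈ halfspaceInter a b)
    (hne : p ∉ (halfspaceInter a b).extremePoints ℝ) :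
    ∃ d : V, d ≠ 0 ∧ ∀ i, a i p = b i → a i d = 0 := by
  have : ∃ x ∈ halfspaceInter a b, ∃ y ∈ halfspaceInter a b, p ∈ openSegment ℝ x y ∧ x ≠ p := by
    by_contra! h
    exact hne ⟨hp, fun x hx y hy hxy => h x hx y hy hxy⟩
  obtain ⟨x, hx, y, hy, ⟨s, t, hs, ht, hst, rfl⟩, hxp⟩ := this
  refine ⟨x - (s • x + t • y), sub_ne_zero.mpr hxp, fun i hi => ?_⟩
  rw [map_sub, hi, sub_eq_zero]
  have h1 := hx i
  have h2 := hy i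
  rw [map_add, map_smul, map_smul, smul_eq_mul, smul_eq_mul] at hi
  obtain rfl : t = 1 - s := by linarith
  nlinarith

variable [Fintype ι]

/-- Moving along a direction in which the tight constraints stay tight, until a further constraint
becomes tight. -/
theorem exists_step_of_tight (hp : p ∈ halfspaceInter a b)
    (hd : ∀ i, a i p = b i → a i d = 0) (hpos : ∃ i, 0 < a i d) :
    ∃ t : ℝ, 0 < t ∧ p + t • d ∈ halfspaceInter a b ∧
      slackCount a b (p + t • d) < slackCount a b p := by
  classical
  obtain ⟨k, hk, hmin⟩ := Finset.exists_min_image (Finset.univ.filter fun i => 0 < a i d)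
    (fun i => (b i - a i p) / a i d) (by obtain ⟨i, hi⟩ := hpos; exact ⟨i, by simpa using hi⟩)
  have hk0 : 0 < a k d := (Finset.mem_filter.mp hk).2
  have hkne : a k p ≠ b k := fun h => hk0.ne' (hd k h)
  have ht : 0 < (b k - a k p) / a k d :=
    div_pos (sub_pos.mpr (lt_of_le_of_ne (hp k) hkne)) hk0
  set t := (b k - a k p) / a k d with htdef
  refine ⟨t, ht, fun i => ?_, Set.ncard_lt_ncard ?_ (Set.toFinite _)⟩
  · rw [map_add, map_smul, smul_eq_mul]
    rcases le_or_gt (a i d) 0 with hi | hi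
    · have := hp i
      nlinarith
    · have := hmin i (by simpa using hi)
      rw [le_div_iff₀ hi] at this
      linarith
  · refine ⟨fun i hi h => hi ?_, fun h => h hkne ?_⟩
    · rw [map_add, map_smul, hd i h, smul_zero, add_zero, h]
    · rw [map_add, map_smul, smul_eq_mul, htdef, div_mul_cancel₀ _ hk0.ne']
      ring

/-- A direction that does not increase the tight constraints can be followed for a while. -/
theorem exists_pos_add_smul_mem (hp : p ∈ halfspaceInter a b)
    (hd : ∀ i, a i p = b i → a i d ≤ 0) :
    ∃ t : ℝ, 0 < t ∧ p + t • d ∈ halfspaceInter a b := by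
  have key : ∀ᶠ t : ℝ in nhdsWithin 0 (Set.Ioi 0), ∀ i, a i (p + t • d) ≤ b i := by
    rw [Filter.eventually_all]
    intro i
    simp only [map_add, map_smul, smul_eq_mul]
    rcases (hp i).eq_or_lt with h | h
    · filter_upwards [self_mem_nhdsWithin] with t ht
      have := mul_nonpos_of_nonneg_of_nonpos (le_of_lt (Set.mem_Ioi.mp ht)) (hd i h)
      linarith
    · have hc : Continuous fun t : ℝ => a i p + t * a i d := by fun_prop
      have := hc.continuousAt.eventually_lt (x₀ := (0 : ℝ)) continuousAt_const
        (by simpa using h : a i p + 0 * a i d < b i)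
      exact (this.filter_mono nhdsWithin_le_nhds).mono fun t ht => ht.le
  obtain ⟨t, ht, ht0⟩ := (key.and self_mem_nhdsWithin).exists
  exact ⟨t, ht0, ht⟩

/-- A linear functional that is at most `v` at the extreme points of a pointed polyhedron and
non-positive on its recession cone is at most `v` on the polyhedron. -/
theorem le_of_le_on_extremePoints (hpt : ∀ d, (∀ i, a i d = 0) → d = 0) (f : V →ₗ[ℝ] ℝ) (v : ℝ)
    (hext : ∀ p ∈ (halfspaceInter a b).extremePoints ℝ, f p ≤ v)
    (hrec : ∀ d ∈ halfspaceInter a 0, f d ≤ 0) :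
    ∀ p ∈ halfspaceInter a b, f p ≤ v := by
  intro p hp
  induction hn : slackCount a b p using Nat.strong_induction_on generalizing p with
  | _ n ih =>
    subst hn
    by_cases hpe : p ∈ (halfspaceInter a b).extremePoints ℝ
    · exact hext p hpe
    obtain ⟨d, hd0, hd⟩ := exists_direction_of_not_extreme hp hpe
    -- Induct on the number of slack constraints. Along `d` or `-d` one either hits a new
    -- constraint, where induction applies, or stays inside forever, where the direction is
    -- recessive and `f` does not increase. In every case `f p ≤ v` follows.
    have step : ∀ d : V, (∀ i, a i p = b i → a i d = 0) → (∃ i, 0 < a i d) →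
        ∃ t : ℝ, 0 < t ∧ f p + t * f d ≤ v := by
      intro d hd hpos
      obtain ⟨t, ht, hmem, hlt⟩ := exists_step_of_tight hp hd hpos
      refine ⟨t, ht, ?_⟩
      simpa using ih _ hlt _ hmem rfl
    have hd' : ∀ i, a i p = b i → a i (-d) = 0 := fun i hi => by rw [map_neg, hd i hi, neg_zero]
    by_cases h1 : ∃ i, 0 < a i d
    · obtain ⟨t, ht, h1⟩ := step d hd h1
      by_cases h2 : ∃ i, 0 < a i (-d)
      · obtain ⟨s, hs, h2⟩ := step (-d) hd' h2
        rw [map_neg] at h2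
        rcases le_total 0 (f d) with h | h <;> nlinarith
      · push Not at h2
        have := hrec (-d) h2
        rw [map_neg] at this
        nlinarith
    · push Not at h1
      have h2 : ∃ i, 0 < a i (-d) := by
        by_contra! h2
        exact hd0 (hpt d fun i => le_antisymm (h1 i) (by simpa using h2 i))
      obtain ⟨s, hs, h2⟩ := step (-d) hd' h2
      rw [map_neg] at h2
      have := hrec d h1
      nlinarith

/-- A non-empty pointed polyhedron has an extreme point. -/
theorem extremePoints_nonempty_of_pointed (hpt : ∀ d, (∀ i, a i d = 0) → d = 0)
    (hne : (halfspaceInter a b).Nonempty) :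
    ((halfspaceInter a b).extremePoints ℝ).Nonempty := by
  by_contra h
  rw [Set.not_nonempty_iff_eq_empty] at h
  obtain ⟨p, hp⟩ := hne
  -- Without extreme points the bound on them is vacuous, so the zero functional would be at most
  -- `-1`.
  have := le_of_le_on_extremePoints hpt (0 : V →ₗ[ℝ] ℝ) (-1) (by simp [h]) (by simp) p hp
  simp only [LinearMap.zero_apply] at this
  linarith

/-- A polyhedron has finitely many extreme points. -/
theorem finite_extremePoints : ((halfspaceInter a b).extremePoints ℝ).Finite := by
  refine Set.Finite.of_finite_image (f := fun p => {i | a i p = b i}) (Set.toFinite _) ?_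
  intro p hp q hq hpq
  have htight : ∀ i, a i p = b i → a i q = b i := fun i hi =>
    (Set.ext_iff.mp hpq i).mp hi
  -- An extreme point is determined by its tight set: if `q` shares that of `p`, the segment from
  -- `q` to `p` extends beyond `p`, forcing `q = p`.
  obtain ⟨t, ht, hmem⟩ := exists_pos_add_smul_mem (d := p - q) hp.1 fun i hi => by
    rw [map_sub, hi, htight i hi, sub_self]
  refine (hp.2 hq.1 hmem ⟨t / (1 + t), 1 / (1 + t), by positivity, by positivity, ?_, ?_⟩).symm
  · field_simp
    ring
  · have : (1 + t) ≠ 0 := by positivity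
    match_scalars <;> field_simp
    ring

/-- The half-line generated by `g`. -/
def halfLine (g : V) : Set V := {g' | ∃ t : ℝ, 0 ≤ t ∧ g' = t • g}

/-- A linear functional that is non-positive on the extreme rays of a polyhedral cone with compact
base is non-positive on the cone. -/
theorem nonpos_of_nonpos_on_extremeRays (σ : V →ₗ[ℝ] ℝ)
    (hσ : ∀ g ∈ halfspaceInter a 0, g ≠ 0 → 0 < σ g) (f : V →ₗ[ℝ] ℝ)
    (hray : ∀ g, g ≠ 0 → IsExtreme ℝ (halfspaceInter a 0) (halfLine g) → f g ≤ 0) :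
    ∀ g ∈ halfspaceInter a 0, f g ≤ 0 := by
  intro g hg
  induction hn : slackCount a 0 g using Nat.strong_induction_on generalizing g with
  | _ n ih =>
    subst hn
    by_cases hg0 : g = 0
    · simp [hg0]
    by_cases hge : IsExtreme ℝ (halfspaceInter a 0) (halfLine g)
    · exact hray g hg0 hge
    have hsub : halfLine g ⊆ halfspaceInter a 0 := by
      rintro _ ⟨t, ht, rfl⟩ i
      rw [map_smul, smul_eq_mul]
      exact mul_nonpos_of_nonneg_of_nonpos ht (hg i)
    have : ∃ x ∈ halfspaceInter a 0, ∃ y ∈ halfspaceInter a 0, ∃ z ∈ halfLine g,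
        z ∈ openSegment ℝ x y ∧ x ∉ halfLine g := by
      by_contra! h
      exact hge ⟨hsub, fun x hx y hy z hz hxy => h x hx y hy z hz hxy⟩
    obtain ⟨x, hx, y, hy, _, ⟨r, hr, rfl⟩, ⟨s, t, hs, ht, hst, hz⟩, hxg⟩ := this
    have hσg := hσ g hg hg0
    have hx0 : 0 ≤ σ x := by
      by_cases h : x = 0
      · simp [h]
      · exact (hσ x hx h).le
    -- Correcting `x` by a multiple of `g` gives a nonzero direction inside the slice `σ = σ g`.
    -- Since `σ` is positive on the cone minus the origin, neither `e` nor `-e` is in the cone, so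
    -- both directions meet a new constraint.
    set e := x - (σ x / σ g) • g with he
    have he0 : e ≠ 0 := fun h => hxg ⟨σ x / σ g, by positivity, sub_eq_zero.mp h⟩
    have hσe : σ e = 0 := by
      rw [he, map_sub, map_smul, smul_eq_mul, div_mul_cancel₀ _ hσg.ne', sub_self]
    have hae : ∀ i, a i g = (0 : ι → ℝ) i → a i e = 0 := by
      intro i hi
      rw [Pi.zero_apply] at hi
      have h1 := hx i
      have h2 := hy i
      have h3 := congrArg (a i) hz
      simp only [map_add, map_smul, smul_eq_mul, hi, mul_zero, Pi.zero_apply] at h1 h2 h3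
      rw [he, map_sub, map_smul, hi, smul_zero, sub_zero]
      nlinarith
    have step : ∀ e : V, e ≠ 0 → σ e = 0 → (∀ i, a i g = (0 : ι → ℝ) i → a i e = 0) →
        ∃ t : ℝ, 0 < t ∧ f g + t * f e ≤ 0 := by
      intro e he0 hσe hae
      obtain ⟨t, ht, hmem, hlt⟩ := exists_step_of_tight hg hae (by
        by_contra! h
        exact (hσ e h he0).ne' hσe)
      refine ⟨t, ht, ?_⟩
      simpa using ih _ hlt _ hmem rfl
    obtain ⟨t₁, ht₁, h₁⟩ := step e he0 hσe hae
    obtain ⟨t₂, ht₂, h₂⟩ := step (-e) (neg_ne_zero.mpr he0) (by rw [map_neg, hσe, neg_zero])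
      fun i hi => by rw [map_neg, hae i hi, neg_zero]
    rw [map_neg] at h₂
    rcases le_total 0 (f e) with h | h <;> nlinarith

/-- Generators of extreme rays of a polyhedral cone with the same tight constraints generate the
same ray. -/
theorem sameRay_of_tight_eq {g g' : V}
    (hg : IsExtreme ℝ (halfspaceInter a 0) (halfLine g))
    (hg' : IsExtreme ℝ (halfspaceInter a 0) (halfLine g'))
    (h : {i | a i g = 0} = {i | a i g' = 0}) : SameRay ℝ g g' := by
  have mem_self : ∀ g : V, g ∈ halfLine g := fun g => ⟨1, zero_le_one, (one_smul _ _).symm⟩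
  have hgm := hg.subset (mem_self g)
  have hgm' := hg'.subset (mem_self g')
  obtain ⟨t, ht, hmem⟩ := exists_pos_add_smul_mem (d := -g') hgm fun i hi => by
    rw [map_neg, show a i g' = 0 from (Set.ext_iff.mp h i).mp hi, neg_zero]
  have hscale : ∀ x ∈ halfspaceInter a 0, ∀ s : ℝ, 0 ≤ s → s • x ∈ halfspaceInter a 0 := by
    intro x hx s hs i
    rw [map_smul, smul_eq_mul]
    exact mul_nonpos_of_nonneg_of_nonpos hs (hx i)
  -- `g` is the midpoint of `2t g'` and `2(g - t g')`, both in the cone, so extremality puts `2t g'`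
  -- on the half-line of `g`.
  obtain ⟨s, hs, hsg⟩ := hg.left_mem_of_mem_openSegment
    (hscale g' hgm' (2 * t) (by positivity)) (hscale _ hmem 2 zero_le_two) (mem_self g)
    ⟨1 / 2, 1 / 2, by norm_num, by norm_num, by norm_num, by module⟩
  have h1 : SameRay ℝ g (s • g) := SameRay.sameRay_nonneg_smul_right g hs
  rw [← hsg] at h1
  have h2 := h1.nonneg_smul_right (inv_nonneg.mpr (by positivity : 0 ≤ 2 * t))
  rwa [inv_smul_smul₀ (by positivity)] at h2

end Polyhedra

namespace FirstStageProgram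

variable {ι : Type} {P Q S : FirstStageProgram ι}

theorem Equivalent.symm (h : P.Equivalent Q) : Q.Equivalent P :=
  ⟨h.1.symm, fun x => (h.2 x).symm⟩

theorem Equivalent.trans (h : P.Equivalent Q) (h' : Q.Equivalent S) : P.Equivalent S :=
  ⟨h.1.trans h'.1, fun x => (h.2 x).trans (h'.2 x)⟩

end FirstStageProgram

/-! ### The dual polyhedron and its generators -/

namespace TwoStageRO

variable {mx nx nu ny rx ru ry : ℕ} (D : TwoStageRO mx nx nu ny rx ru ry)

/-- The linear functionals defining `Π` and its recession cone. -/
noncomputable def dualRows : Fin ry ⊕ Fin ny → (Fin ry → ℝ) →ₗ[ℝ] ℝ :=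
  Sum.elim (fun i => -LinearMap.proj i) fun j => LinearMap.proj j ∘ₗ D.B₂ᵀ.mulVecLin

theorem mem_halfspaceInter_dualRows {b : Fin ry ⊕ Fin ny → ℝ} {p : Fin ry → ℝ} :
    p ∈ halfspaceInter D.dualRows b ↔
      (∀ i, -p i ≤ b (Sum.inl i)) ∧ ∀ j, (D.B₂ᵀ *ᵥ p) j ≤ b (Sum.inr j) :=
  Sum.forall

theorem dualPoly_eq : D.dualPoly = halfspaceInter D.dualRows (Sum.elim 0 D.c₂) := by
  ext p
  rw [mem_halfspaceInter_dualRows]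
  simp [dualPoly, Pi.le_def]

theorem recCone_eq : D.recCone = halfspaceInter D.dualRows 0 := by
  ext p
  rw [mem_halfspaceInter_dualRows]
  simp [recCone, Pi.le_def]

theorem dualRows_pointed (p : Fin ry → ℝ) (h : ∀ i, D.dualRows i p = 0) : p = 0 :=
  funext fun i => neg_eq_zero.mp (h (Sum.inl i))

theorem extPts_finite : D.extPts.Finite := by
  rw [extPts, dualPoly_eq]
  exact finite_extremePoints

theorem extPts_nonempty (h : D.dualPoly.Nonempty) : D.extPts.Nonempty := by
  rw [extPts, dualPoly_eq] at *
  exact extremePoints_nonempty_of_pointed D.dualRows_pointed h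

theorem IsExtremeRaySet.finite {R : Set (Fin ry → ℝ)} (hR : D.IsExtremeRaySet R) : R.Finite := by
  refine Set.Finite.of_finite_image (f := fun g => {i | D.dualRows i g = 0}) (Set.toFinite _) ?_
  intro g hg g' hg' h
  have h1 := hR.1 g hg
  have h2 := (hR.1 g' hg').2
  have h3 := h1.2
  rw [recCone_eq] at h2 h3
  exact (hR.2 g h1).unique ⟨hg, SameRay.refl g⟩ ⟨hg', sameRay_of_tight_eq h3 h2 h⟩

variable {D}

/-- A bound for a linear functional on the extreme points of `Π`, with a non-positive value on its
extreme rays, is a bound on `Π`. -/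
theorem dotProduct_le_of_le_on_generators {R : Set (Fin ry → ℝ)} (hR : D.IsExtremeRaySet R)
    {w : Fin ry → ℝ} {v : ℝ} (hext : ∀ p ∈ D.extPts, w ⬝ᵥ p ≤ v) (hray : ∀ g ∈ R, w ⬝ᵥ g ≤ 0) :
    ∀ p ∈ D.dualPoly, w ⬝ᵥ p ≤ v := by
  rw [extPts, dualPoly_eq] at *
  refine le_of_le_on_extremePoints D.dualRows_pointed (dotProductBilin ℝ ℝ w) v hext ?_
  refine nonpos_of_nonpos_on_extremeRays (dotProductBilin ℝ ℝ 1) (fun g hg hg0 => ?_) _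
    fun g hg0 hg => ?_
  · rw [← recCone_eq] at hg
    refine lt_of_le_of_ne (dotProduct_nonneg_of_nonneg zero_le_one hg.1) fun h => hg0 ?_
    change 0 = 1 ⬝ᵥ g at h
    rw [one_dotProduct, eq_comm, Finset.sum_eq_zero_iff_of_nonneg fun i _ => hg.1 i] at h
    exact funext fun i => h i (Finset.mem_univ i)
  · have hray' : D.IsExtremeRay g := ⟨hg0, by rw [recCone_eq]; exact hg⟩
    obtain ⟨g', ⟨hg', hsame⟩, -⟩ := hR.2 g hray'
    obtain ⟨r, s, hr, hs, hrs⟩ := hsame.exists_pos hg0 (hR.1 g' hg').1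
    have h1 := congrArg (w ⬝ᵥ ·) hrs
    simp only [dotProduct_smul, smul_eq_mul] at h1
    have h2 := hray g' hg'
    change w ⬝ᵥ g ≤ 0
    nlinarith

theorem recCone_dotProduct_nonpos {w g : Fin ry → ℝ} {v : ℝ} (hne : D.dualPoly.Nonempty)
    (h : ∀ p ∈ D.dualPoly, w ⬝ᵥ p ≤ v) (hg : g ∈ D.recCone) : w ⬝ᵥ g ≤ 0 := by
  obtain ⟨p, hp⟩ := hne
  by_contra! hpos
  have key : ∀ t : ℝ, 0 ≤ t → w ⬝ᵥ p + t * (w ⬝ᵥ g) ≤ v := by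
    intro t ht
    have := h (p + t • g) ⟨add_nonneg hp.1 (smul_nonneg ht hg.1), by
      rw [mulVec_add, mulVec_smul]
      simpa using add_le_add hp.2 (smul_nonpos_of_nonneg_of_nonpos ht hg.2)⟩
    simpa [dotProduct_add, dotProduct_smul] using this
  have h0 := key 0 le_rfl
  have h1 := key ((v - w ⬝ᵥ p + 1) / (w ⬝ᵥ g)) (div_nonneg (by linarith) hpos.le)
  rw [div_mul_cancel₀ _ hpos.ne'] at h1
  linarith

theorem IsExtremeRaySet.subset_recCone {R : Set (Fin ry → ℝ)} (hR : D.IsExtremeRaySet R) :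
    R ⊆ D.recCone :=
  fun g hg => (hR.1 g hg).2.subset ⟨1, zero_le_one, (one_smul _ _).symm⟩

/-! ### The recourse problem -/

theorem dotProduct_le_recourse {p : Fin ry → ℝ} (hp : p ∈ D.dualPoly)
    (x : Fin mx ⊕ Fin nx → ℝ) (u : Fin nu → ℝ) :
    (((D.d - D.B₁ *ᵥ x - D.E *ᵥ u) ⬝ᵥ p : ℝ) : EReal) ≤ D.recourse x u :=
  le_iInf₂ fun _ hy => EReal.coe_le_coe_iff.mpr (dual_le_primal hy.1 hy.2 hp.1 hp.2)

theorem recourse_ne_bot (hne : D.dualPoly.Nonempty) (x : Fin mx ⊕ Fin nx → ℝ) (u : Fin nu → ℝ) :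
    D.recourse x u ≠ ⊥ := by
  obtain ⟨p, hp⟩ := hne
  exact ne_bot_of_le_ne_bot (EReal.coe_ne_bot _) (dotProduct_le_recourse hp x u)

theorem recourse_le_of_mem {x : Fin mx ⊕ Fin nx → ℝ} {u : Fin nu → ℝ} {y : Fin ny → ℝ} {v : ℝ}
    (hy : y ∈ D.Y x u) (hv : D.c₂ ⬝ᵥ y ≤ v) : D.recourse x u ≤ v :=
  iInf₂_le_of_le y hy (EReal.coe_le_coe_iff.mpr hv)

theorem recourse_le_iff_dual (hne : D.dualPoly.Nonempty) {x : Fin mx ⊕ Fin nx → ℝ}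
    {u : Fin nu → ℝ} {v : ℝ} :
    D.recourse x u ≤ v ↔ ∀ p ∈ D.dualPoly, (D.d - D.B₁ *ᵥ x - D.E *ᵥ u) ⬝ᵥ p ≤ v := by
  refine ⟨fun h p hp => EReal.coe_le_coe_iff.mp ((dotProduct_le_recourse hp x u).trans h),
    fun h => ?_⟩
  obtain ⟨y, h1, h2, h3⟩ := exists_primal_of_dual_le D.B₂ _ D.c₂ v hne fun p hp hc => h p ⟨hp, hc⟩
  exact recourse_le_of_mem ⟨h1, h2⟩ h3

theorem recourse_le_iff_primal (hne : D.dualPoly.Nonempty) {x : Fin mx ⊕ Fin nx → ℝ}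
    {u : Fin nu → ℝ} {v : ℝ} : D.recourse x u ≤ v ↔ ∃ y ∈ D.Y x u, D.c₂ ⬝ᵥ y ≤ v := by
  refine ⟨fun h => ?_, fun ⟨y, hy, hv⟩ => recourse_le_of_mem hy hv⟩
  obtain ⟨y, h1, h2, h3⟩ := exists_primal_of_dual_le D.B₂ _ D.c₂ v hne
    fun p hp hc => (recourse_le_iff_dual hne).mp h p ⟨hp, hc⟩
  exact ⟨y, ⟨h1, h2⟩, h3⟩

theorem recourse_eq_iSup_dual (hne : D.dualPoly.Nonempty) (x : Fin mx ⊕ Fin nx → ℝ)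
    (u : Fin nu → ℝ) : D.recourse x u =
      ⨆ p ∈ D.dualPoly, (((D.d - D.B₁ *ᵥ x - D.E *ᵥ u) ⬝ᵥ p : ℝ) : EReal) := by
  refine le_antisymm ?_ (iSup₂_le fun p hp => dotProduct_le_recourse hp x u)
  have hle : ∀ p ∈ D.dualPoly, (((D.d - D.B₁ *ᵥ x - D.E *ᵥ u) ⬝ᵥ p : ℝ) : EReal) ≤
      ⨆ p ∈ D.dualPoly, (((D.d - D.B₁ *ᵥ x - D.E *ᵥ u) ⬝ᵥ p : ℝ) : EReal) :=
    fun p hp => le_iSup₂_of_le p hp le_rfl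
  revert hle
  generalize (⨆ p ∈ D.dualPoly, (((D.d - D.B₁ *ᵥ x - D.E *ᵥ u) ⬝ᵥ p : ℝ) : EReal)) = s
  induction s with
  | bot =>
    intro hle
    obtain ⟨p, hp⟩ := hne
    exact absurd (le_bot_iff.mp (hle p hp)) (EReal.coe_ne_bot _)
  | coe v =>
    exact fun hle => (recourse_le_iff_dual hne).mpr fun p hp => EReal.coe_le_coe_iff.mp (hle p hp)
  | top => exact fun _ => le_top

theorem dualPoly_nonempty (hA3 : D.A3) : D.dualPoly.Nonempty := by
  obtain ⟨⟨_, x, hx, u, hu, y, hy, -⟩, r, hr⟩ := hA3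
  obtain ⟨p, h1, h2, -⟩ := exists_dual_of_primal_le D.B₂ (D.d - D.B₁ *ᵥ x - D.E *ᵥ u) D.c₂
    (r - D.c₁ ⬝ᵥ x) ⟨y, hy⟩ fun y' h1 h2 => by
      have := hr ⟨x, hx, u, hu, y', ⟨h1, h2⟩, rfl⟩
      linarith
  exact ⟨p, h1, h2⟩

/-! ### The lower-level linear programs -/

theorem neg_mulVec_dotProduct_eq (u : Fin nu → ℝ) (β : Fin ry → ℝ) :
    -(D.E *ᵥ u) ⬝ᵥ β = -(D.Eᵀ *ᵥ β) ⬝ᵥ u := by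
  rw [neg_dotProduct, neg_dotProduct, dotProduct_comm, dotProduct_mulVec, mulVec_transpose]

theorem kktProj_eq_lpArgmax (x : Fin mx ⊕ Fin nx → ℝ) (β : Fin ry → ℝ) :
    D.kktProj x β = D.lpArgmax x β := by
  ext u
  set k := D.h + D.G *ᵥ x
  set w := -(D.Eᵀ *ᵥ β) with hw
  have slack : ∀ l : Fin ru → ℝ,
      l ⬝ᵥ (k - D.F x *ᵥ u) + u ⬝ᵥ ((D.F x)ᵀ *ᵥ l + D.Eᵀ *ᵥ β) = k ⬝ᵥ l - w ⬝ᵥ u := by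
    intro l
    have e : u ⬝ᵥ ((D.F x)ᵀ *ᵥ l) = l ⬝ᵥ (D.F x *ᵥ u) := by
      rw [mulVec_transpose, dotProduct_comm, dotProduct_mulVec]
    rw [hw, dotProduct_sub, dotProduct_add u, e, dotProduct_comm k, neg_dotProduct,
      dotProduct_comm u]
    ring
  constructor
  · rintro ⟨l, hF, hE, h1, h2, hu, hl⟩
    refine ⟨⟨hu, hF⟩, fun u' hu' => ?_⟩
    rw [neg_mulVec_dotProduct_eq, neg_mulVec_dotProduct_eq]
    have e1 : l ⬝ᵥ (k - D.F x *ᵥ u) = 0 := Finset.sum_eq_zero fun i _ => congrFun h1 i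
    have e2 : u ⬝ᵥ ((D.F x)ᵀ *ᵥ l + D.Eᵀ *ᵥ β) = 0 := Finset.sum_eq_zero fun i _ => congrFun h2 i
    have := slack l
    have hd := dual_le_primal (B := (D.F x)ᵀ) hl hE hu'.1 (by simpa using hu'.2)
    rw [← hw]
    linarith
  · rintro ⟨⟨hu, hF⟩, hmax⟩
    obtain ⟨l, hl, h1, h2⟩ := exists_dual_of_primal_le (-D.F x) (-k) (-w) (-(w ⬝ᵥ u))
      ⟨u, hu, by simpa [neg_mulVec] using hF⟩ fun u' hu' hF' => by
        have := hmax u' ⟨hu', by simpa [neg_mulVec] using hF'⟩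
        rw [neg_mulVec_dotProduct_eq, neg_mulVec_dotProduct_eq] at this
        rw [neg_dotProduct w]
        exact neg_le_neg this
    have h1' : w ≤ (D.F x)ᵀ *ᵥ l := by simpa [neg_mulVec] using h1
    have h2' : k ⬝ᵥ l ≤ w ⬝ᵥ u := by simpa using h2
    have n1 : ∀ i, 0 ≤ l i * (k - D.F x *ᵥ u) i := fun i =>
      mul_nonneg (hl i) (sub_nonneg.mpr (hF i))
    have n2 : ∀ j, 0 ≤ u j * ((D.F x)ᵀ *ᵥ l + D.Eᵀ *ᵥ β) j := fun j =>
      mul_nonneg (hu j) (neg_le_iff_add_nonneg.mp (h1' j))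
    have s1 : 0 ≤ l ⬝ᵥ (k - D.F x *ᵥ u) := Finset.sum_nonneg fun i _ => n1 i
    have s2 : 0 ≤ u ⬝ᵥ ((D.F x)ᵀ *ᵥ l + D.Eᵀ *ᵥ β) := Finset.sum_nonneg fun i _ => n2 i
    have := slack l
    have z1 : l ⬝ᵥ (k - D.F x *ᵥ u) = 0 := by linarith
    have z2 : u ⬝ᵥ ((D.F x)ᵀ *ᵥ l + D.Eᵀ *ᵥ β) = 0 := by linarith
    exact ⟨l, hF, h1',
      funext fun i => (Finset.sum_eq_zero_iff_of_nonneg fun i _ => n1 i).mp z1 i (by simp),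
      funext fun j => (Finset.sum_eq_zero_iff_of_nonneg fun j _ => n2 j).mp z2 j (by simp), hu, hl⟩

theorem isClosed_U (x : Fin mx ⊕ Fin nx → ℝ) : IsClosed (D.U x) :=
  (isClosed_le continuous_const continuous_id).inter
    (isClosed_le (continuous_const.matrix_mulVec continuous_id) continuous_const)

theorem lpArgmax_nonempty (hA1 : D.A1) (hA2 : D.A2) {x : Fin mx ⊕ Fin nx → ℝ} (hx : x ∈ D.X)
    (β : Fin ry → ℝ) : (D.lpArgmax x β).Nonempty := by
  obtain ⟨u, hu, hmax⟩ := (Metric.isCompact_of_isClosed_isBounded (isClosed_U x)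
    (hA2 x hx)).exists_isMaxOn (hA1 x hx) (f := fun u => -(D.E *ᵥ u) ⬝ᵥ β) (by fun_prop)
  exact ⟨u, hu, fun u' hu' => hmax hu'⟩

theorem lpValue_eq {x : Fin mx ⊕ Fin nx → ℝ} {β : Fin ry → ℝ} {u : Fin nu → ℝ}
    (hu : u ∈ D.lpArgmax x β) : D.lpValue x β = ((-(D.E *ᵥ u) ⬝ᵥ β : ℝ) : EReal) :=
  le_antisymm (iSup₂_le fun u' hu' => EReal.coe_le_coe_iff.mpr (hu.2 u' hu'))
    (le_iSup₂_of_le u hu.1 le_rfl)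

theorem dotProduct_le_of_mem_lpArgmax {x : Fin mx ⊕ Fin nx → ℝ} {β : Fin ry → ℝ}
    {u u' : Fin nu → ℝ} (hu : u ∈ D.lpArgmax x β) (hu' : u' ∈ D.U x) :
    (D.d - D.B₁ *ᵥ x - D.E *ᵥ u') ⬝ᵥ β ≤ (D.d - D.B₁ *ᵥ x - D.E *ᵥ u) ⬝ᵥ β := by
  have := hu.2 u' hu'
  rw [neg_dotProduct, neg_dotProduct] at this
  rw [sub_dotProduct, sub_dotProduct _ (D.E *ᵥ u)]
  linarith

/-! ### The worst case -/

theorem recourse_le_worstCase {x : Fin mx ⊕ Fin nx → ℝ} {u : Fin nu → ℝ} {S : Set (Fin nu → ℝ)}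
    (hu : u ∈ S) : D.recourse x u ≤ D.worstCase x S :=
  le_iSup₂_of_le u hu le_rfl

theorem worstCase_U_ne_bot (hA1 : D.A1) (hne : D.dualPoly.Nonempty) {x : Fin mx ⊕ Fin nx → ℝ}
    (hx : x ∈ D.X) : D.worstCase x (D.U x) ≠ ⊥ := by
  obtain ⟨u, hu⟩ := hA1 x hx
  exact ne_bot_of_le_ne_bot (recourse_ne_bot hne x u) (recourse_le_worstCase hu)

/-- The worst case is controlled by optimal solutions of the lower-level linear programs. -/
theorem worstCase_le_of_lpArgmax {R : Set (Fin ry → ℝ)} (hR : D.IsExtremeRaySet R)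
    (hne : D.dualPoly.Nonempty) {x : Fin mx ⊕ Fin nx → ℝ} {v : ℝ}
    (hext : ∀ p ∈ D.extPts, ∃ u ∈ D.lpArgmax x p, (D.d - D.B₁ *ᵥ x - D.E *ᵥ u) ⬝ᵥ p ≤ v)
    (hray : ∀ g ∈ R, ∃ u ∈ D.lpArgmax x g, (D.d - D.B₁ *ᵥ x - D.E *ᵥ u) ⬝ᵥ g ≤ 0) :
    D.worstCase x (D.U x) ≤ v := by
  refine iSup₂_le fun u hu => (recourse_le_iff_dual hne).mpr <|
    dotProduct_le_of_le_on_generators hR (fun p hp => ?_) fun g hg => ?_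
  · obtain ⟨u', h1, h2⟩ := hext p hp
    exact (dotProduct_le_of_mem_lpArgmax h1 hu).trans h2
  · obtain ⟨u', h1, h2⟩ := hray g hg
    exact (dotProduct_le_of_mem_lpArgmax h1 hu).trans h2

theorem dotProduct_le_of_recourse_le {p : Fin ry → ℝ} {x : Fin mx ⊕ Fin nx → ℝ}
    {u : Fin nu → ℝ} {v : ℝ} (hp : p ∈ D.dualPoly) (h : D.recourse x u ≤ v) :
    (D.d - D.B₁ *ᵥ x - D.E *ᵥ u) ⬝ᵥ p ≤ v :=
  EReal.coe_le_coe_iff.mp ((dotProduct_le_recourse hp x u).trans h)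

theorem dotProduct_nonpos_of_recourse_ne_top (hne : D.dualPoly.Nonempty) {g : Fin ry → ℝ}
    {x : Fin mx ⊕ Fin nx → ℝ} {u : Fin nu → ℝ} (hg : g ∈ D.recCone) (h : D.recourse x u ≠ ⊤) :
    (D.d - D.B₁ *ᵥ x - D.E *ᵥ u) ⬝ᵥ g ≤ 0 := by
  lift D.recourse x u to ℝ using ⟨h, recourse_ne_bot hne x u⟩ with v hv
  exact recCone_dotProduct_nonpos hne ((recourse_le_iff_dual hne).mp hv.ge) hg

theorem criticalSet_subset_U (R : Set (Fin ry → ℝ)) (x : Fin mx ⊕ Fin nx → ℝ) :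
    D.criticalSet R x ⊆ D.U x := by
  have key : ∀ β : Fin ry → ℝ, D.kktProj x β ⊆ D.U x := fun β => by
    rw [kktProj_eq_lpArgmax]
    exact fun u hu => hu.1
  exact Set.union_subset (Set.iUnion₂_subset fun _ _ => key _) (Set.iUnion₂_subset fun _ _ => key _)

theorem exists_recourse_eq_worstCase (hA1 : D.A1) (hA2 : D.A2) {R : Set (Fin ry → ℝ)}
    (hR : D.IsExtremeRaySet R) (hne : D.dualPoly.Nonempty) {x : Fin mx ⊕ Fin nx → ℝ}
    (hx : x ∈ D.X) : ∃ u ∈ D.criticalSet R x, D.recourse x u = D.worstCase x (D.U x) := by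
  by_contra! hcon
  have hlt : ∀ u ∈ D.criticalSet R x, D.recourse x u < D.worstCase x (D.U x) := fun u hu =>
    lt_of_le_of_ne (recourse_le_worstCase (criticalSet_subset_U R x hu)) (hcon u hu)
  choose s hs using lpArgmax_nonempty hA1 hA2 hx
  have hsp : ∀ p ∈ D.extPts, s p ∈ D.criticalSet R x := fun p hp =>
    Or.inl (Set.mem_biUnion hp (by rw [kktProj_eq_lpArgmax]; exact hs p))
  have hsg : ∀ g ∈ R, s g ∈ D.criticalSet R x := fun g hg =>
    Or.inr (Set.mem_biUnion hg (by rw [kktProj_eq_lpArgmax]; exact hs g))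
  obtain ⟨q, hq, hmax⟩ := D.extPts_finite.exists_maximalFor (fun p => D.recourse x (s p)) _
    (D.extPts_nonempty hne)
  have hq' := hlt _ (hsp q hq)
  have hmax' : ∀ p ∈ D.extPts, D.recourse x (s p) ≤ D.recourse x (s q) := fun p hp =>
    (le_total _ _).elim id fun h => hmax hp h
  lift D.recourse x (s q) to ℝ using ⟨hq'.ne_top, recourse_ne_bot hne x _⟩ with v
  exact hq'.not_ge (worstCase_le_of_lpArgmax hR hne
    (fun p hp => ⟨s p, hs p, dotProduct_le_of_recourse_le hp.1 (hmax' p hp)⟩)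
    fun g hg => ⟨s g, hs g, dotProduct_nonpos_of_recourse_ne_top hne (hR.subset_recCone hg)
      (hlt _ (hsg g hg)).ne_top⟩)

theorem worstCase_U_eq_criticalSet (hA1 : D.A1) (hA2 : D.A2) {R : Set (Fin ry → ℝ)}
    (hR : D.IsExtremeRaySet R) (hne : D.dualPoly.Nonempty) {x : Fin mx ⊕ Fin nx → ℝ}
    (hx : x ∈ D.X) : D.worstCase x (D.U x) = D.worstCase x (D.criticalSet R x) := by
  obtain ⟨u, hu, h⟩ := exists_recourse_eq_worstCase hA1 hA2 hR hne hx
  exact le_antisymm (h ▸ recourse_le_worstCase hu)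
    (biSup_mono fun u hu => criticalSet_subset_U R x hu)

/-! ### Equivalent formulations -/

/-- A program in which the possible values `η` of the second stage, for a given `x`, are the upper
bounds of the worst case is equivalent to the original problem. -/
theorem original_equivalent_of_feasible_iff (hA1 : D.A1) (hne : D.dualPoly.Nonempty)
    {P : FirstStageProgram (Fin mx ⊕ Fin nx)}
    (h₁ : ∀ z ∈ P.feasible, P.firstStage z ∈ D.X ∧ ∃ η : ℝ,
      P.objective z = ((D.c₁ ⬝ᵥ P.firstStage z + η : ℝ) : EReal) ∧
      D.worstCase (P.firstStage z) (D.U (P.firstStage z)) ≤ η)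
    (h₂ : ∀ x ∈ D.X, ∀ η : ℝ, D.worstCase x (D.U x) ≤ η → ∃ z ∈ P.feasible,
      P.firstStage z = x ∧ P.objective z = ((D.c₁ ⬝ᵥ x + η : ℝ) : EReal)) :
    D.original.Equivalent P := by
  have hle : ∀ z ∈ P.feasible, D.original.objective (P.firstStage z) ≤ P.objective z := by
    intro z hz
    obtain ⟨-, η, hη, hw⟩ := h₁ z hz
    rw [hη, EReal.coe_add]
    exact add_le_add le_rfl hw
  have hex : ∀ x ∈ D.X, D.original.objective x ≠ ⊤ → ∃ z ∈ P.feasible,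
      P.firstStage z = x ∧ P.objective z = D.original.objective x := by
    intro x hx htop
    have hbot := worstCase_U_ne_bot hA1 hne hx
    have htop' : D.worstCase x (D.U x) ≠ ⊤ := fun h => htop (by
      change ((D.c₁ ⬝ᵥ x : ℝ) : EReal) + D.worstCase x (D.U x) = ⊤
      rw [h, EReal.coe_add_top])
    obtain ⟨η, hη⟩ : ∃ η : ℝ, (η : EReal) = D.worstCase x (D.U x) :=
      ⟨_, EReal.coe_toReal htop' hbot⟩
    obtain ⟨z, hz, h1, h2⟩ := h₂ x hx η hη.ge
    refine ⟨z, hz, h1, h2.trans ?_⟩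
    rw [EReal.coe_add, hη]
    rfl
  have hval : D.original.value = P.value := by
    refine le_antisymm (le_iInf₂ fun z hz => iInf₂_le_of_le _ (h₁ z hz).1 (hle z hz))
      (le_iInf₂ fun x hx => ?_)
    by_cases htop : D.original.objective x = ⊤
    · exact htop ▸ le_top
    · obtain ⟨z, hz, -, h2⟩ := hex x hx htop
      exact iInf₂_le_of_le z hz h2.le
  refine ⟨hval, fun x => ⟨?_, ?_⟩⟩
  · rintro ⟨x, ⟨hx, htop, hbot, heq⟩, rfl⟩
    obtain ⟨z, hz, h1, h2⟩ := hex x hx htop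
    exact ⟨z, ⟨hz, h2 ▸ htop, h2 ▸ hbot, by rw [h2, heq, hval]⟩, h1⟩
  · rintro ⟨z, ⟨hz, htop, hbot, heq⟩, rfl⟩
    have hx := (h₁ z hz).1
    have hobj : D.original.objective (P.firstStage z) = P.objective z :=
      le_antisymm (hle z hz) (by rw [heq, ← hval]; exact iInf₂_le _ hx)
    exact ⟨P.firstStage z, ⟨hx, hobj ▸ htop, hobj ▸ hbot, by rw [hobj, heq, hval]⟩, rfl⟩

theorem original_equivalent_epigraph (hA1 : D.A1) (hne : D.dualPoly.Nonempty) :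
    D.original.Equivalent D.epigraph := by
  refine original_equivalent_of_feasible_iff hA1 hne (fun z hz => ⟨hz.1, z.2, rfl, ?_⟩) ?_
  · exact iSup₂_le fun u hu => (recourse_le_iff_primal hne).mpr (hz.2 u hu)
  · exact fun x hx η h => ⟨(x, η), ⟨hx, fun u hu =>
      (recourse_le_iff_primal hne).mp ((recourse_le_worstCase hu).trans h)⟩, rfl, rfl⟩

theorem original_equivalent_dualized (hne : D.dualPoly.Nonempty) :
    D.original.Equivalent D.dualized := by
  have : D.original = D.dualized := by
    simp only [original, dualized, worstCase, recourse_eq_iSup_dual hne]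
  rw [this]
  exact ⟨rfl, fun _ => Iff.rfl⟩

theorem ray_le_of_worstCase_le {R : Set (Fin ry → ℝ)} (hR : D.IsExtremeRaySet R)
    (hne : D.dualPoly.Nonempty) {x : Fin mx ⊕ Fin nx → ℝ} {η : ℝ}
    (h : D.worstCase x (D.U x) ≤ η) {g : Fin ry → ℝ} (hg : g ∈ R) {u : Fin nu → ℝ}
    (hu : u ∈ D.U x) : (D.d - D.B₁ *ᵥ x - D.E *ᵥ u) ⬝ᵥ g ≤ 0 :=
  dotProduct_nonpos_of_recourse_ne_top hne (hR.subset_recCone hg)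
    (ne_top_of_le_ne_top (EReal.coe_ne_top η) ((recourse_le_worstCase hu).trans h))

theorem original_equivalent_sigma (hA1 : D.A1) (hA2 : D.A2) {R : Set (Fin ry → ℝ)}
    (hR : D.IsExtremeRaySet R) (hne : D.dualPoly.Nonempty) :
    D.original.Equivalent (D.sigma R) := by
  have key : ∀ {x β u} (v : ℝ), u ∈ D.lpArgmax x β →
      ((((D.d - D.B₁ *ᵥ x) ⬝ᵥ β : ℝ) : EReal) + D.lpValue x β ≤ (v : EReal) ↔
        (D.d - D.B₁ *ᵥ x - D.E *ᵥ u) ⬝ᵥ β ≤ v) := by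
    intro x β u v hu
    rw [lpValue_eq hu, ← EReal.coe_add, EReal.coe_le_coe_iff, sub_eq_add_neg _ (D.E *ᵥ u),
      add_dotProduct]
  refine original_equivalent_of_feasible_iff hA1 hne (fun z hz => ⟨hz.1, z.2, rfl, ?_⟩) ?_
  · refine worstCase_le_of_lpArgmax hR hne (fun p hp => ?_) fun g hg => ?_
    · obtain ⟨u, hu⟩ := lpArgmax_nonempty hA1 hA2 hz.1 p
      exact ⟨u, hu, (key _ hu).mp (hz.2.1 p hp)⟩
    · obtain ⟨u, hu⟩ := lpArgmax_nonempty hA1 hA2 hz.1 g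
      exact ⟨u, hu, (key 0 hu).mp (hz.2.2 g hg)⟩
  · refine fun x hx η h => ⟨(x, η), ⟨hx, fun p hp => ?_, fun g hg => ?_⟩, rfl, rfl⟩
    · obtain ⟨u, hu⟩ := lpArgmax_nonempty hA1 hA2 hx p
      exact (key _ hu).mpr
        (dotProduct_le_of_recourse_le hp.1 ((recourse_le_worstCase hu.1).trans h))
    · obtain ⟨u, hu⟩ := lpArgmax_nonempty hA1 hA2 hx g
      exact (key 0 hu).mpr (ray_le_of_worstCase_le hR hne h hg hu.1)

theorem exists_mem_kkt (hA1 : D.A1) (hA2 : D.A2) {x : Fin mx ⊕ Fin nx → ℝ} (hx : x ∈ D.X)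
    (β : Fin ry → ℝ) : ∃ u l, (u, l) ∈ D.kkt x β := by
  obtain ⟨u, hu⟩ := lpArgmax_nonempty hA1 hA2 hx β
  rw [← kktProj_eq_lpArgmax] at hu
  exact ⟨u, hu⟩

theorem mem_lpArgmax_of_mem_kkt {x : Fin mx ⊕ Fin nx → ℝ} {β : Fin ry → ℝ} {u : Fin nu → ℝ}
    {l : Fin ru → ℝ} (h : (u, l) ∈ D.kkt x β) : u ∈ D.lpArgmax x β := by
  rw [← kktProj_eq_lpArgmax]
  exact ⟨l, h⟩

theorem original_equivalent_sigmaK (hA1 : D.A1) (hA2 : D.A2) {R : Set (Fin ry → ℝ)}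
    (hR : D.IsExtremeRaySet R) (hne : D.dualPoly.Nonempty) :
    D.original.Equivalent (D.sigmaK R) := by
  have key : ∀ (x : Fin mx ⊕ Fin nx → ℝ) (β : Fin ry → ℝ) (u : Fin nu → ℝ),
      β ⬝ᵥ D.d - β ⬝ᵥ (D.B₁ *ᵥ x) - β ⬝ᵥ (D.E *ᵥ u) = (D.d - D.B₁ *ᵥ x - D.E *ᵥ u) ⬝ᵥ β := by
    intro x β u
    rw [← dotProduct_sub, ← dotProduct_sub, dotProduct_comm]
  refine original_equivalent_of_feasible_iff hA1 hne (fun z hz => ⟨hz.1, z.η, rfl, ?_⟩) ?_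
  · refine worstCase_le_of_lpArgmax hR hne (fun p hp => ?_) fun g hg => ?_
    · obtain ⟨h1, h2⟩ := hz.2.1 ⟨p, hp⟩
      exact ⟨_, mem_lpArgmax_of_mem_kkt h2, key _ _ _ ▸ h1⟩
    · obtain ⟨h1, h2⟩ := hz.2.2 ⟨g, hg⟩
      exact ⟨_, mem_lpArgmax_of_mem_kkt h2, key _ _ _ ▸ h1⟩
  · intro x hx η h
    choose u l hul using exists_mem_kkt hA1 hA2 hx
    have hu := fun β => (mem_lpArgmax_of_mem_kkt (hul β)).1
    refine ⟨⟨x, η, fun p => u p, fun p => l p, fun g => u g, fun g => l g⟩,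
      ⟨hx, fun p => ⟨?_, hul p⟩, fun g => ⟨?_, hul g⟩⟩, rfl, rfl⟩
    · rw [key]
      exact dotProduct_le_of_recourse_le p.2.1 ((recourse_le_worstCase (hu p)).trans h)
    · rw [key]
      exact ray_le_of_worstCase_le hR hne h g.2 (hu g)

theorem original_equivalent_omega (hA1 : D.A1) (hA2 : D.A2) {R : Set (Fin ry → ℝ)}
    (hR : D.IsExtremeRaySet R) (hne : D.dualPoly.Nonempty) :
    D.original.Equivalent (D.omega R) := by
  refine original_equivalent_of_feasible_iff hA1 hne (fun z hz => ⟨hz.1, z.η, rfl, ?_⟩) ?_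
  · refine worstCase_le_of_lpArgmax hR hne (fun p hp => ?_) fun g hg => ?_
    · obtain ⟨h1, h2, h3⟩ := hz.2.1 ⟨p, hp⟩
      exact ⟨_, h3, dotProduct_le_of_recourse_le hp.1 (recourse_le_of_mem h2 h1)⟩
    · obtain ⟨h1, h2⟩ := hz.2.2 ⟨g, hg⟩
      exact ⟨_, h2, dotProduct_nonpos_of_recourse_ne_top hne (hR.subset_recCone hg)
        (ne_top_of_le_ne_top (EReal.coe_ne_top _) (recourse_le_of_mem h1 le_rfl))⟩
  · intro x hx η h
    choose u hu using lpArgmax_nonempty hA1 hA2 hx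
    choose y hy hyη using fun β =>
      (recourse_le_iff_primal hne).mp ((recourse_le_worstCase (hu β).1).trans h)
    exact ⟨⟨x, η, fun p => u p, fun p => y p, fun g => u g, fun g => y g⟩,
      ⟨hx, fun p => ⟨hyη p, hy p, hu p⟩, fun g => ⟨hy g, hu g⟩⟩, rfl, rfl⟩

theorem original_equivalent_omegaK (hA1 : D.A1) (hA2 : D.A2) {R : Set (Fin ry → ℝ)}
    (hR : D.IsExtremeRaySet R) (hne : D.dualPoly.Nonempty) :
    D.original.Equivalent (D.omegaK R) := by
  refine original_equivalent_of_feasible_iff hA1 hne (fun z hz => ⟨hz.1, z.η, rfl, ?_⟩) ?_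
  · refine worstCase_le_of_lpArgmax hR hne (fun p hp => ?_) fun g hg => ?_
    · obtain ⟨h1, h2, h3, h4⟩ := hz.2.1 ⟨p, hp⟩
      exact ⟨_, mem_lpArgmax_of_mem_kkt h4,
        dotProduct_le_of_recourse_le hp.1 (recourse_le_of_mem ⟨h2, h3⟩ h1)⟩
    · obtain ⟨h1, h2, h3⟩ := hz.2.2 ⟨g, hg⟩
      exact ⟨_, mem_lpArgmax_of_mem_kkt h3,
        dotProduct_nonpos_of_recourse_ne_top hne (hR.subset_recCone hg)
          (ne_top_of_le_ne_top (EReal.coe_ne_top _) (recourse_le_of_mem ⟨h2, h1⟩ le_rfl))⟩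
  · intro x hx η h
    choose u l hul using exists_mem_kkt hA1 hA2 hx
    choose y hy hyη using fun β => (recourse_le_iff_primal hne).mp
      ((recourse_le_worstCase (mem_lpArgmax_of_mem_kkt (hul β)).1).trans h)
    exact ⟨⟨⟨x, η, fun p => u p, fun p => y p, fun g => u g, fun g => y g⟩,
        fun p => l p, fun g => l g⟩,
      ⟨hx, fun p => ⟨hyη p, (hy p).1, (hy p).2, hul p⟩,
        fun g => ⟨(hy g).2, (hy g).1, hul g⟩⟩, rfl, rfl⟩

end TwoStageRO

theorem mainTheorem4 {mx nx nu ny rx ru ry : ℕ}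
    (D : TwoStageRO mx nx nu ny rx ru ry) (hA1 : D.A1) (hA2 : D.A2) (hA3 : D.A3)
    (R : Set (Fin ry → ℝ)) (hR : D.IsExtremeRaySet R) :
    -- there are finitely many extreme points and extreme rays, and at least one extreme point
    (D.extPts.Finite ∧ D.extPts.Nonempty ∧ R.Finite) ∧
    -- the projected sets `OU(x, β)`, `OV(x, β)` are the optimal-solution sets of `LP(x, β)`
    (∀ x ∈ D.X, ∀ β : Fin ry → ℝ, D.kktProj x β = D.lpArgmax x β) ∧
    -- for a given `x`, the worst cases over `U(x)` and over the union agree and are attained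
    (∀ x ∈ D.X, D.worstCase x (D.U x) = D.worstCase x (D.criticalSet R x) ∧
      D.criticalSet R x ⊆ D.U x ∧
      ∃ u ∈ D.criticalSet R x, D.recourse x u = D.worstCase x (D.U x)) ∧
    -- the problem is equivalent to the bilevel program and to the single-level program
    D.original.Equivalent (D.omega R) ∧
    D.original.Equivalent (D.omegaK R) ∧
    (D.omega R).Equivalent (D.omegaK R) ∧
    -- so are its other equivalent formulations
    D.epigraph.Equivalent (D.omega R) ∧
    D.dualized.Equivalent (D.omega R) ∧
    (D.sigma R).Equivalent (D.omega R) ∧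
    (D.sigmaK R).Equivalent (D.omega R) := by
  have hne := TwoStageRO.dualPoly_nonempty hA3
  have hom := TwoStageRO.original_equivalent_omega hA1 hA2 hR hne
  have homK := TwoStageRO.original_equivalent_omegaK hA1 hA2 hR hne
  exact ⟨⟨D.extPts_finite, D.extPts_nonempty hne, TwoStageRO.IsExtremeRaySet.finite D hR⟩,
    fun x _ β => TwoStageRO.kktProj_eq_lpArgmax x β,
    fun x hx => ⟨TwoStageRO.worstCase_U_eq_criticalSet hA1 hA2 hR hne hx,
      TwoStageRO.criticalSet_subset_U R x,
      TwoStageRO.exists_recourse_eq_worstCase hA1 hA2 hR hne hx⟩,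
    hom, homK, hom.symm.trans homK,
    (TwoStageRO.original_equivalent_epigraph hA1 hne).symm.trans hom,
    (TwoStageRO.original_equivalent_dualized hne).symm.trans hom,
    (TwoStageRO.original_equivalent_sigma hA1 hA2 hR hne).symm.trans hom,
    (TwoStageRO.original_equivalent_sigmaK hA1 hA2 hR hne).symm.trans hom⟩
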